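/- Let $\mathcal{M}_{\mathbb{Q}}$ be the ring whose elements are the ratios $[f/g]$ of monic polynomials $f,g\in\mathbb{Q}[x]$, whose addition is multiplication of rational functions, and whose multiplication is the bi-additive operation determined by $$\Big[\prod_i (x-\alpha_i)\Big]\cdot\Big[\prod_j (x-\beta_j)\Big]=\Big[\prod_{i,j}(x-\alpha_i\beta_j)\Big]$$ (roots taken in $\mathbb{C}$). For $k\ge 0$ let $t_k:\mathcal{M}_{\mathbb{Q}}\to\mathbb{Q}$ be the ring morphism given by the $k$-th power sum of the roots, $t_k\big(\big[\prod_i(x-\alpha_i)\big]\big)=\sum_i\alpha_i^k$, with $0^0=1$. Give $\mathcal{M}_{\mathbb{Q}}$ the topology induced by the injection $(t_k)_{k\ge0}:\mathcal{M}_{\mathbb{Q}}\to\prod_{k\ge0}\mathbb{Q}$, where each factor is discrete and the product has the product topology. For a continuous ring endomorphism $\phi$ of $\mathcal{M}_{\mathbb{Q}}$ and $n\ge0$, let $\phi^*(n)$ be the unique integer $m\ge 0$ such that $t_n(\phi(r))=t_m(r)$ for all $r\in\mathcal{M}_{\mathbb{Q}}$ (it always exists). For $n\ge 1$ let $\lambda_n$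 be the ring endomorphism of $\mathcal{M}_{\mathbb{Q}}$ with $\lambda_n\big(\big[\prod_i(x-\alpha_i)\big]\big)=\big[\prod_i(x-\alpha_i^n)\big]$. A root of $[f/g]$, with $f,g$ coprime, is a complex root of $f$ or of $g$. **Proposition.** Let $\phi$ be a continuous ring endomorphism of $\mathcal{M}_{\mathbb{Q}}$ with $\phi^*(1)\ne0$, and suppose that for some integer $k\ge2$ the element $\phi([x-k])$ has a root of absolute value greater than $1$. Then $\phi=\lambda_{\phi^*(1)}+(t_{\phi^*(0)}-t_0)[x]$; that is, for every $r\in\mathcal{M}_{\mathbb{Q}}$ the rational number $t_{\phi^*(0)}(r)-t_0(r)$ is an integer and $$\phi(r)=\lambda_{\phi^*(1)}(r)+\big(t_{\phi^*(0)}(r)-t_0(r)\big)\cdot[x].$$ Moreover $\phi^*(n)=\phi^*(1)\,n$ for all $n\ge0$. -/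

import Mathlib

open Polynomial

noncomputable section

namespace MonicRatio

/-! ### The ring of ratios of monic rational polynomials -/

/-- The class `[f]` of a polynomial `f ∈ ℚ[X]`, as a formal sum `∑ᵢ [x - αᵢ]` over its complex roots
`αᵢ`, counted with multiplicity. The generator `[x - α]` is the basis element `single α 1` of the
monoid ring `ℤ[(ℂ, *)]`, so that `[x - α] * [x - β] = [x - αβ]`. -/
def rootSum (f : ℚ[X]) : MonoidAlgebra ℤ ℂ :=
  ((f.aroots ℂ).map fun α => MonoidAlgebra.single α (1 : ℤ)).sum

lemma rootSum_one : rootSum 1 = 0 := by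
  simp [rootSum, Polynomial.aroots_def]

lemma rootSum_mul {f g : ℚ[X]} (hf : f.Monic) (hg : g.Monic) :
    rootSum (f * g) = rootSum f + rootSum g := by
  rw [rootSum, Polynomial.aroots_mul (mul_ne_zero hf.ne_zero hg.ne_zero), Multiset.map_add,
    Multiset.sum_add, rootSum, rootSum]

lemma rootSum_X_sub_C (a : ℚ) : rootSum (X - C a) = MonoidAlgebra.single (a : ℂ) (1 : ℤ) := by
  simp [rootSum, Polynomial.aroots_X_sub_C]

lemma coeff_rootSum (f : ℚ[X]) (α : ℂ) : (rootSum f).coeff α = ((f.aroots ℂ).count α : ℤ) := by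
  rw [rootSum]
  induction f.aroots ℂ using Multiset.induction_on with
  | empty => simp
  | cons b s ih =>
    rw [Multiset.map_cons, Multiset.sum_cons, MonoidAlgebra.coeff_add, Finsupp.add_apply, ih,
      Multiset.count_cons, MonoidAlgebra.coeff_single, Finsupp.single_apply]
    by_cases h : α = b
    · simp [h, add_comm]
    · simp [h, Ne.symm h]

lemma monic_ext_aroots {f g : ℚ[X]} (hf : f.Monic) (hg : g.Monic)
    (h : f.aroots ℂ = g.aroots ℂ) : f = g := by
  apply Polynomial.map_injective (algebraMap ℚ ℂ) (algebraMap ℚ ℂ).injective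
  rw [(IsAlgClosed.splits (f.map (algebraMap ℚ ℂ))).eq_prod_roots_of_monic (hf.map _),
    (IsAlgClosed.splits (g.map (algebraMap ℚ ℂ))).eq_prod_roots_of_monic (hg.map _)]
  rw [Polynomial.aroots_def, Polynomial.aroots_def] at h
  rw [h]

/-- `[f] - [g]` depends exactly on the ratio `f / g`. -/
lemma rootSum_sub_eq_iff {f g f' g' : ℚ[X]} (hf : f.Monic) (hg : g.Monic) (hf' : f'.Monic)
    (hg' : g'.Monic) : rootSum f - rootSum g = rootSum f' - rootSum g' ↔ f * g' = f' * g := by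
  rw [sub_eq_sub_iff_add_eq_add, ← rootSum_mul hf hg', ← rootSum_mul hf' hg]
  refine ⟨fun h => monic_ext_aroots (hf.mul hg') (hf'.mul hg) ?_, fun h => by rw [h]⟩
  ext α
  have := congrArg (fun r => r.coeff α) h
  simpa only [coeff_rootSum, Nat.cast_inj] using this

/-- Elimination: `∏ G(α)` over the roots `α` of a monic rational polynomial is rational. -/
lemma exists_map_eq_prod_eval {f : ℚ[X]} (hf : f.Monic) (G : ℚ[X][X]) :
    ∃ h : ℚ[X], h.map (algebraMap ℚ ℂ) =
      ((f.aroots ℂ).map fun α =>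
        (G.map (Polynomial.mapRingHom (algebraMap ℚ ℂ))).eval (C α)).prod := by
  refine ⟨resultant (f.map C) G, ?_⟩
  have h1 := resultant_map_map (f.map C) G (f.map C).natDegree G.natDegree
    (Polynomial.mapRingHom (algebraMap ℚ ℂ))
  rw [Polynomial.coe_mapRingHom] at h1
  rw [← h1]
  have h2 : (f.map C).map (Polynomial.mapRingHom (algebraMap ℚ ℂ)) =
      (f.map (algebraMap ℚ ℂ)).map C := by
    rw [Polynomial.map_map, Polynomial.map_map]
    congr 1
    ext; simp
  have h3 : (f.map C).natDegree = ((f.map (algebraMap ℚ ℂ)).map C).natDegree := by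
    rw [(hf.map _).natDegree_map, hf.natDegree_map, hf.natDegree_map]
  have hs : (f.map (algebraMap ℚ ℂ)).Splits := IsAlgClosed.splits _
  rw [h2, h3, resultant_eq_prod_eval _ _ _ natDegree_map_le (hs.map C),
    ((hf.map _).map _).leadingCoeff, one_pow, one_mul, hs.roots_map_of_injective C_injective,
    Multiset.map_map]
  rfl

/-- A monic complex polynomial with rational coefficients, given by its roots. -/
lemma exists_monic_of_roots {s : Multiset ℂ} {h : ℚ[X]}
    (hh : h.map (algebraMap ℚ ℂ) = (s.map fun α => X - C α).prod) :
    h.Monic ∧ h.aroots ℂ = s := by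
  constructor
  · apply Polynomial.monic_of_injective (algebraMap ℚ ℂ).injective
    rw [hh]
    exact monic_multiset_prod_of_monic _ _ fun α _ => monic_X_sub_C α
  · rw [Polynomial.aroots_def, hh, Polynomial.roots_multiset_prod_X_sub_C]

lemma scaleRoots_prod (s : Multiset ℂ) (a : ℂ) :
    (s.map fun β => X - C β).prod.scaleRoots a = (s.map fun β => X - C (a * β)).prod := by
  induction s using Multiset.induction_on with
  | empty => simp
  | cons b s ih =>
    simp only [Multiset.map_cons, Multiset.prod_cons]
    rw [mul_scaleRoots_of_noZeroDivisors, ih]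
    congr 1
    rw [sub_eq_add_neg, ← C_neg, X_add_C_scaleRoots, sub_eq_add_neg, ← C_neg]
    ring_nf

/-- The polynomial `∏ᵢⱼ (x - αᵢ βⱼ)` has rational coefficients. -/
lemma exists_mul {f g : ℚ[X]} (hf : f.Monic) (hg : g.Monic) :
    ∃ h : ℚ[X], h.Monic ∧
      h.aroots ℂ = (f.aroots ℂ).bind fun α => (g.aroots ℂ).map fun β => α * β := by
  obtain ⟨h, hh⟩ := exists_map_eq_prod_eval hf
    (∑ i ∈ Finset.range (g.natDegree + 1), C (monomial i (g.coeff i)) * X ^ (g.natDegree - i))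
  refine ⟨h, exists_monic_of_roots ?_⟩
  rw [hh, Multiset.map_bind, Multiset.prod_bind]
  congr 1
  refine Multiset.map_congr rfl fun α _ => ?_
  have hs : (g.map (algebraMap ℚ ℂ)).Splits := IsAlgClosed.splits _
  have := scaleRoots_prod (g.aroots ℂ) α
  rw [Polynomial.aroots_def, ← hs.eq_prod_roots_of_monic (hg.map _)] at this
  rw [Multiset.map_map]
  simp only [Function.comp_def]
  rw [Polynomial.aroots_def, ← this]
  ext j
  simp only [coeff_scaleRoots, natDegree_map, coeff_map, Polynomial.map_sum, Polynomial.map_mul,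
    map_C, Polynomial.map_pow, map_X, eval_finsetSum, eval_mul, eval_C, eval_pow, eval_X,
    coe_mapRingHom, map_monomial, finsetSum_coeff, ← C_pow, coeff_mul_C, coeff_monomial]
  by_cases hj : j ≤ g.natDegree
  · rw [Finset.sum_eq_single j]
    · simp
    · intro b _ hb; simp [hb]
    · intro hb; exact absurd (Finset.mem_range.2 (Nat.lt_succ_of_le hj)) hb
  · rw [coeff_eq_zero_of_natDegree_lt (not_le.1 hj), map_zero, zero_mul]
    refine Finset.sum_eq_zero fun b hb => ?_
    have : b ≠ j := by rintro rfl; exact hj (Nat.le_of_lt_succ (Finset.mem_range.1 hb))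
    simp [this]

/-- The polynomial `∏ᵢ (x - αᵢⁿ)` has rational coefficients. -/
lemma exists_pow {f : ℚ[X]} (hf : f.Monic) (n : ℕ) :
    ∃ h : ℚ[X], h.Monic ∧ h.aroots ℂ = (f.aroots ℂ).map fun α => α ^ n := by
  obtain ⟨h, hh⟩ := exists_map_eq_prod_eval hf (C X - X ^ n)
  refine ⟨h, exists_monic_of_roots ?_⟩
  rw [hh, Multiset.map_map]
  simp

lemma exists_rootSum_mul {f g : ℚ[X]} (hf : f.Monic) (hg : g.Monic) :
    ∃ h : ℚ[X], h.Monic ∧ rootSum h = rootSum f * rootSum g := by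
  obtain ⟨h, hm, hr⟩ := exists_mul hf hg
  refine ⟨h, hm, ?_⟩
  rw [rootSum, hr, Multiset.map_bind, Multiset.sum_bind, rootSum, rootSum,
    ← Multiset.sum_map_mul_right]
  congr 1
  refine Multiset.map_congr rfl fun α _ => ?_
  rw [← Multiset.sum_map_mul_left, Multiset.map_map]
  congr 1
  refine Multiset.map_congr rfl fun β _ => ?_
  simp [MonoidAlgebra.single_mul_single]

lemma exists_rootSum_pow {f : ℚ[X]} (hf : f.Monic) (n : ℕ) :
    ∃ h : ℚ[X], h.Monic ∧
      rootSum h = MonoidAlgebra.mapDomainRingHom ℤ (powMonoidHom n) (rootSum f) := by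
  obtain ⟨h, hm, hr⟩ := exists_pow hf n
  refine ⟨h, hm, ?_⟩
  rw [rootSum, hr, Multiset.map_map, rootSum, map_multiset_sum, Multiset.map_map]
  congr 1
  refine Multiset.map_congr rfl fun α _ => ?_
  simp

/-- The ring `M_ℚ` of ratios `f / g` of monic polynomials `f, g ∈ ℚ[X]`. The ratio `f / g` is
represented by `[f] - [g]`; addition is multiplication of rational functions and multiplication is
determined by `[∏ (x - αᵢ)] * [∏ (x - βⱼ)] = [∏ (x - αᵢ βⱼ)]`. -/
def MQ : Subring (MonoidAlgebra ℤ ℂ) where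
  carrier := {r | ∃ f g : ℚ[X], f.Monic ∧ g.Monic ∧ r = rootSum f - rootSum g}
  zero_mem' := ⟨1, 1, monic_one, monic_one, by simp⟩
  one_mem' := ⟨X - C 1, 1, monic_X_sub_C 1, monic_one, by
    rw [rootSum_X_sub_C, rootSum_one, sub_zero, MonoidAlgebra.one_def]; simp⟩
  neg_mem' := by
    rintro _ ⟨f, g, hf, hg, rfl⟩
    exact ⟨g, f, hg, hf, by abel⟩
  add_mem' := by
    rintro _ _ ⟨f, g, hf, hg, rfl⟩ ⟨f', g', hf', hg', rfl⟩
    refine ⟨f * f', g * g', hf.mul hf', hg.mul hg', ?_⟩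
    rw [rootSum_mul hf hf', rootSum_mul hg hg']
    abel
  mul_mem' := by
    rintro _ _ ⟨f, g, hf, hg, rfl⟩ ⟨f', g', hf', hg', rfl⟩
    obtain ⟨a, ha, ha'⟩ := exists_rootSum_mul hf hf'
    obtain ⟨b, hb, hb'⟩ := exists_rootSum_mul hg hg'
    obtain ⟨c, hc, hc'⟩ := exists_rootSum_mul hf hg'
    obtain ⟨d, hd, hd'⟩ := exists_rootSum_mul hg hf'
    refine ⟨a * b, c * d, ha.mul hb, hc.mul hd, ?_⟩
    rw [rootSum_mul ha hb, rootSum_mul hc hd, ha', hb', hc', hd']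
    ring

/-- The element `[f] = [f / 1]` of `M_ℚ`, for a monic polynomial `f`. -/
def cls (f : ℚ[X]) (hf : f.Monic) : MQ :=
  ⟨rootSum f, f, 1, hf, monic_one, by rw [rootSum_one, sub_zero]⟩

/-- The element `[x - a]` of `M_ℚ`; in particular `[x]` is `lin 0`. -/
def lin (a : ℚ) : MQ := cls (X - C a) (monic_X_sub_C a)

/-- The order of the rational function `r` at `α ∈ ℂ`: positive at a zero, negative at a pole. -/
def ord (r : MQ) (α : ℂ) : ℤ := (r : MonoidAlgebra ℤ ℂ).coeff α

/-- `α ∈ ℂ` is a root of `r = f / g` (in lowest terms) if it is a root of `f` or of `g`. -/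
def IsRootOf (r : MQ) (α : ℂ) : Prop := ord r α ≠ 0

lemma isRootOf_iff {r : MQ} {f g : ℚ[X]} (hf : f.Monic) (hg : g.Monic) (hfg : IsCoprime f g)
    (hr : (r : MonoidAlgebra ℤ ℂ) = rootSum f - rootSum g) (α : ℂ) :
    IsRootOf r α ↔ aeval α f = 0 ∨ aeval α g = 0 := by
  have hf' : aeval α f = 0 ↔ 0 < (f.aroots ℂ).count α := by
    rw [Multiset.count_pos, mem_aroots]; exact ⟨fun h => ⟨hf.ne_zero, h⟩, fun h => h.2⟩
  have hg' : aeval α g = 0 ↔ 0 < (g.aroots ℂ).count α := by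
    rw [Multiset.count_pos, mem_aroots]; exact ⟨fun h => ⟨hg.ne_zero, h⟩, fun h => h.2⟩
  have hnot : ¬ (aeval α f = 0 ∧ aeval α g = 0) := by
    rintro ⟨h1, h2⟩
    obtain ⟨u, v, huv⟩ := hfg
    have := congrArg (aeval α) huv
    simp [h1, h2] at this
  rw [IsRootOf, ord, hr, MonoidAlgebra.coeff_sub, Finsupp.sub_apply, coeff_rootSum, coeff_rootSum]
  rw [hf', hg'] at *
  omega

/-! ### The power sums `t_k` and the topology -/

/-- The ring morphism `[x - α] ↦ α ^ k` (with `0 ^ 0 = 1`), with complex values. -/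
def tC (k : ℕ) : MonoidAlgebra ℤ ℂ →+* ℂ :=
  (MonoidAlgebra.lift ℤ ℂ ℂ (powMonoidHom k)).toRingHom

lemma tC_single (k : ℕ) (α : ℂ) (c : ℤ) : tC k (MonoidAlgebra.single α c) = c * α ^ k := by
  simp [tC]

lemma exists_tC_rootSum {f : ℚ[X]} (hf : f.Monic) (k : ℕ) : ∃ q : ℚ, (q : ℂ) = tC k (rootSum f) := by
  obtain ⟨h, hm, hr⟩ := exists_pow hf k
  have hs : (h.map (algebraMap ℚ ℂ)).Splits := IsAlgClosed.splits _
  refine ⟨-h.nextCoeff, ?_⟩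
  have h1 : tC k (rootSum f) = (h.aroots ℂ).sum := by
    rw [hr, rootSum, map_multiset_sum, Multiset.map_map]
    congr 1
    refine Multiset.map_congr rfl fun α _ => ?_
    simp [tC_single]
  have h2 := hs.nextCoeff_eq_neg_sum_roots_of_monic (hm.map _)
  rw [Polynomial.nextCoeff_map (algebraMap ℚ ℂ).injective] at h2
  rw [h1, Polynomial.aroots_def, ← neg_neg (Multiset.sum _), ← h2]
  simp

lemma exists_tC (k : ℕ) (r : MQ) : ∃ q : ℚ, (q : ℂ) = tC k r := by
  obtain ⟨r, f, g, hf, hg, rfl⟩ := r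
  obtain ⟨a, ha⟩ := exists_tC_rootSum hf k
  obtain ⟨b, hb⟩ := exists_tC_rootSum hg k
  exact ⟨a - b, by rw [map_sub, ← ha, ← hb]; push_cast; rfl⟩

/-- The ring morphism `t_k : M_ℚ → ℚ`, the `k`-th power sum of the roots: `[x - α] ↦ α ^ k`,
with `0 ^ 0 = 1`, so that `t_0` is the degree. -/
def t (k : ℕ) : MQ →+* ℚ where
  toFun r := (exists_tC k r).choose
  map_one' := by
    apply Rat.cast_injective (α := ℂ)
    rw [(exists_tC k 1).choose_spec]; simp
  map_zero' := by
    apply Rat.cast_injective (α := ℂ)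
    rw [(exists_tC k 0).choose_spec]; simp
  map_mul' r s := by
    apply Rat.cast_injective (α := ℂ)
    rw [Rat.cast_mul, (exists_tC k _).choose_spec, (exists_tC k _).choose_spec,
      (exists_tC k _).choose_spec]; simp
  map_add' r s := by
    apply Rat.cast_injective (α := ℂ)
    rw [Rat.cast_add, (exists_tC k _).choose_spec, (exists_tC k _).choose_spec,
      (exists_tC k _).choose_spec]; simp

lemma t_spec (k : ℕ) (r : MQ) : ((t k r : ℚ) : ℂ) = tC k r := (exists_tC k r).choose_spec

lemma t_lin (k : ℕ) (a : ℚ) : t k (lin a) = a ^ k := by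
  apply Rat.cast_injective (α := ℂ)
  rw [t_spec]
  simp [lin, cls, rootSum_X_sub_C, tC_single]

/-- The topology of `M_ℚ`: the one induced by `(t_k)_{k ≥ 0} : M_ℚ → ∏_k ℚ`, where each factor `ℚ`
is discrete and the product carries the product topology. -/
instance instTopologicalSpaceMQ : TopologicalSpace MQ :=
  TopologicalSpace.induced (fun r (k : ℕ) => t k r)
    (@Pi.topologicalSpace ℕ (fun _ => ℚ) (fun _ => ⊥))

/-! ### The endomorphisms `λ_n` -/

/-- The endomorphism `λ_n` of `M_ℚ`, sending `[∏ (x - αᵢ)]` to `[∏ (x - αᵢ ^ n)]`. -/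
def lam (n : ℕ) : MQ →+* MQ :=
  (MonoidAlgebra.mapDomainRingHom ℤ (powMonoidHom n : ℂ →* ℂ)).restrict MQ MQ (by
    rintro _ ⟨f, g, hf, hg, rfl⟩
    obtain ⟨a, ha, ha'⟩ := exists_rootSum_pow hf n
    obtain ⟨b, hb, hb'⟩ := exists_rootSum_pow hg n
    exact ⟨a, b, ha, hb, by rw [map_sub, ha', hb']⟩)

/-! ### The function `φ*` -/

lemma t_index_injective {m m' : ℕ} (h : ∀ r : MQ, t m r = t m' r) : m = m' := by
  have := h (lin 2)
  rw [t_lin, t_lin] at this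
  exact pow_right_injective₀ (by norm_num : (0 : ℚ) < 2) (by norm_num) this

lemma exists_nhd_zero {φ : MQ →+* MQ} (hφ : Continuous φ) (n : ℕ) :
    ∃ N : ℕ, ∀ r : MQ, (∀ k < N, t k r = 0) → t n (φ r) = 0 := by
  let _ : TopologicalSpace ℚ := ⊥
  have : DiscreteTopology ℚ := ⟨rfl⟩
  have hind : Topology.IsInducing (fun (r : MQ) (k : ℕ) => t k r) := ⟨rfl⟩
  have hc : Continuous fun r : MQ => t n (φ r) :=
    ((continuous_apply n).comp hind.continuous).comp hφ
  have ho : IsOpen ((fun r : MQ => t n (φ r)) ⁻¹' {0}) := (isOpen_discrete {0}).preimage hc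
  obtain ⟨U, hU, hUe⟩ := hind.isOpen_iff.1 ho
  have h0 : (fun k => t k (0 : MQ)) ∈ U := by
    have : (0 : MQ) ∈ (fun (r : MQ) (k : ℕ) => t k r) ⁻¹' U := by rw [hUe]; simp
    exact this
  obtain ⟨I, u, hu, hsub⟩ := isOpen_pi_iff.1 hU _ h0
  refine ⟨I.sup id + 1, fun r hr => ?_⟩
  have hmem : r ∈ (fun (r : MQ) (k : ℕ) => t k r) ⁻¹' U := by
    apply hsub
    intro k hk
    have h1 := (hu k hk).2
    have h2 : t k r = 0 := hr k (Nat.lt_succ_of_le (Finset.le_sup (f := id) hk))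
    simpa [h2] using h1
  rw [hUe] at hmem
  exact hmem

/-- For a continuous ring endomorphism `φ` of `M_ℚ` and `n ≥ 0`, there is exactly one `m ≥ 0` with
`t_n ∘ φ = t_m`. -/
lemma existsUnique_t_comp {φ : MQ →+* MQ} (hφ : Continuous φ) (n : ℕ) :
    ∃! m : ℕ, ∀ r : MQ, t n (φ r) = t m r := by
  obtain ⟨N, hN⟩ := exists_nhd_zero hφ n
  have hker : ∃ m : ℕ, ∀ r : MQ, t m r = 0 → t n (φ r) = 0 := by
    by_contra! H
    choose s hs hs' using H
    have h1 : t n (φ (∏ k ∈ Finset.range N, s k)) = 0 := by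
      apply hN
      intro k hk
      rw [map_prod]
      exact Finset.prod_eq_zero (Finset.mem_range.2 hk) (hs k)
    rw [map_prod, map_prod] at h1
    obtain ⟨k, _, hk⟩ := Finset.prod_eq_zero_iff.1 h1
    exact hs' k hk
  obtain ⟨m, hm⟩ := hker
  have key : ∀ r : MQ, t n (φ r) = t m r := by
    intro r
    have hd : ((t m r).den : ℚ) ≠ 0 := by exact_mod_cast (t m r).den_nz
    have h1 : t n (φ (((t m r).den : MQ) * r - ((t m r).num : MQ))) = 0 := by
      apply hm
      rw [map_sub, map_mul, map_natCast, map_intCast, Rat.den_mul_eq_num, sub_self]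
    rw [map_sub, map_sub, map_mul, map_mul, map_natCast, map_natCast, map_intCast, map_intCast,
      ← Rat.den_mul_eq_num, ← mul_sub] at h1
    exact sub_eq_zero.1 ((mul_eq_zero.1 h1).resolve_left hd)
  exact ⟨m, key, fun m' hm' => t_index_injective fun r => by rw [← hm' r, key r]⟩

/-- The function `φ* : ℕ → ℕ` attached to a continuous ring endomorphism `φ` of `M_ℚ`: `φ*(n)` is
the unique `m` with `t_n (φ r) = t_m r` for all `r`. -/
def phiStar (φ : MQ →+* MQ) (hφ : Continuous φ) (n : ℕ) : ℕ := (existsUnique_t_comp hφ n).choose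

lemma phiStar_spec (φ : MQ →+* MQ) (hφ : Continuous φ) (n : ℕ) (r : MQ) :
    t n (φ r) = t (phiStar φ hφ n) r := (existsUnique_t_comp hφ n).choose_spec.1 r

end MonicRatio

end

/-! ### Trivial units in group algebras of torsion-free groups -/

noncomputable section

/-! Degrees are integers and the degree of `φ [x - 1/2]` is `2 ^ (-φ*(0))`, so `φ*(0) = 0`. As the
`t_n` separate points, it remains to show `φ*(n) = φ*(1) n`.

Now `x = φ [x - 2]` is a unit with power sums `2 ^ φ*(n)`. Split `ℂˣ` as roots of unity times a
torsion-free `V`. For each `n`, the map `[ζ v] ↦ ζⁿ [v]` (with `[0] ↦ 0`) is a ring morphism to the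
group algebra of `V` over the algebraic integers, which has only trivial units, so `x` goes to some
`w_n [v_n]` with `w_n` a unit. Frobenius modulo `p` gives `v_{np} = v_n`, so all `v_n` with `n ≥ 1`
equal one `γ`. Applying `[v] ↦ vⁿ` yields `2 ^ φ*(n) = w_n γⁿ` (`exists_tC_eq_of_mul_eq_one`).
Comparing with the `n`-th power of the case `n = 1`, `2 ^ (φ*(n) - φ*(1) n)` is a unit among
algebraic integers, which forces exponent `0`. -/

/-- Only the finitely many elements of `A` and `B` matter, so the question descends to the finitely
generated subgroup `H`. -/
theorem TwoUniqueProds.of_isMulTorsionFree (V : Type*) [CommGroup V] [IsMulTorsionFree V] :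
    TwoUniqueProds V where
  uniqueMul_of_one_lt_card {A B} h := by
    classical
    let H : Subgroup V := Subgroup.closure (A ∪ B : Finset V)
    have : Group.FG H := (Group.fg_iff_subgroup_fg H).2 ⟨A ∪ B, rfl⟩
    have : Monoid.FG H := Group.fg_iff_monoid_fg.1 this
    have hA : ∀ a ∈ A, a ∈ H := fun a ha =>
      Subgroup.subset_closure (Finset.mem_coe.2 (Finset.mem_union_left _ ha))
    have hB : ∀ b ∈ B, b ∈ H := fun b hb =>
      Subgroup.subset_closure (Finset.mem_coe.2 (Finset.mem_union_right _ hb))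
    have hcard : 1 < (A.subtype (· ∈ H)).card * (B.subtype (· ∈ H)).card := by
      rwa [Finset.card_subtype, Finset.card_subtype, Finset.filter_true_of_mem hA,
        Finset.filter_true_of_mem hB]
    obtain ⟨p, hp, q, hq, hpq, hu, hu'⟩ := TwoUniqueProds.uniqueMul_of_one_lt_card hcard
    simp only [Finset.mem_product, Finset.mem_subtype] at hp hq
    have key : ∀ a b : H, UniqueMul (A.subtype (· ∈ H)) (B.subtype (· ∈ H)) a b →
        UniqueMul A B (a : V) b := by
      intro a b hab x y hx hy hxy
      have := hab (a := ⟨x, hA x hx⟩) (b := ⟨y, hB y hy⟩) (by simpa using hx) (by simpa using hy)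
        (Subtype.ext hxy)
      exact ⟨congrArg Subtype.val this.1, congrArg Subtype.val this.2⟩
    refine ⟨(p.1, p.2), Finset.mem_product.2 hp, (q.1, q.2), Finset.mem_product.2 hq,
      fun h => hpq ?_, key _ _ hu, key _ _ hu'⟩
    simp only [Prod.mk.injEq, SetLike.coe_eq_coe] at h
    exact Prod.ext h.1 h.2

/-- The group algebra of a group with unique products over a domain has only trivial units. -/
theorem MonoidAlgebra.eq_single_of_mul_eq_one {R V : Type*} [CommRing R] [IsDomain R]
    [CommGroup V] [TwoUniqueProds V] {x y : MonoidAlgebra R V} (h : x * y = 1) :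
    ∃ (v : V) (a : R), IsUnit a ∧ x = MonoidAlgebra.single v a := by
  classical
  have hone : ∀ v : V, (1 : MonoidAlgebra R V).coeff v ≠ 0 → v = 1 := by
    intro v hv
    by_contra hne
    exact hv (by rw [MonoidAlgebra.one_def, MonoidAlgebra.coeff_single,
      Finsupp.single_eq_of_ne hne])
  have hx : x.coeff.support.Nonempty := by
    rw [Finset.nonempty_iff_ne_empty, Ne, Finsupp.support_eq_empty]
    intro h0
    have : x = 0 := by ext v; simp [h0]
    simp [this] at h
  have hy : y.coeff.support.Nonempty := by
    rw [Finset.nonempty_iff_ne_empty, Ne, Finsupp.support_eq_empty]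
    intro h0
    have : y = 0 := by ext v; simp [h0]
    simp [this] at h
  have hcard : ¬ 1 < x.coeff.support.card * y.coeff.support.card := by
    intro hc
    obtain ⟨p, hp, q, hq, hpq, hu, hu'⟩ := TwoUniqueProds.uniqueMul_of_one_lt_card hc
    -- A uniquely attained product survives in `x * y = 1`, so it equals `1`. Two such pairs then
    -- have the same product, contradicting uniqueness.
    have aux : ∀ r : V × V, r ∈ x.coeff.support ×ˢ y.coeff.support →
        UniqueMul x.coeff.support y.coeff.support r.1 r.2 → r.1 * r.2 = 1 := by
      intro r hr hr'
      apply hone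
      rw [← h, MonoidAlgebra.coeff_mul_mul_of_uniqueMul hr']
      rw [Finset.mem_product, Finsupp.mem_support_iff, Finsupp.mem_support_iff] at hr
      exact mul_ne_zero hr.1 hr.2
    have h2 := hu (Finset.mem_product.1 hq).1 (Finset.mem_product.1 hq).2
      ((aux q hq hu').trans (aux p hp hu).symm)
    exact hpq (Prod.ext h2.1.symm h2.2.symm)
  have hx1 : x.coeff.support.card = 1 := by
    have := hx.card_pos; have := hy.card_pos; nlinarith
  have hy1 : y.coeff.support.card = 1 := by
    have := hx.card_pos; have := hy.card_pos; nlinarith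
  obtain ⟨v, a, -, hva⟩ := Finsupp.card_support_eq_one'.1 hx1
  obtain ⟨w, b, -, hwb⟩ := Finsupp.card_support_eq_one'.1 hy1
  have hx' : x = MonoidAlgebra.single v a := by ext; simp [hva]
  have hy' : y = MonoidAlgebra.single w b := by ext; simp [hwb]
  refine ⟨v, a, ?_, hx'⟩
  rw [hx', hy', MonoidAlgebra.single_mul_single] at h
  have h1 : v * w = 1 := by
    by_contra hne
    have := congrArg (fun z => z.coeff 1) h
    simp [MonoidAlgebra.one_def, MonoidAlgebra.coeff_single, hne] at this
  have := congrArg (fun z => z.coeff 1) h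
  simp only [h1, MonoidAlgebra.one_def, MonoidAlgebra.coeff_single, Finsupp.single_eq_same] at this
  exact IsUnit.of_mul_eq_one _ this

/-- The roots of unity form a divisible, hence injective, abelian group, so their identity map
extends to all of `ℂˣ`. -/
theorem exists_torsion_retraction : ∃ τ : ℂˣ →* ℂˣ,
    (∀ u, IsOfFinOrder (τ u)) ∧ ∀ u, IsOfFinOrder u → τ u = u := by
  let T := AddCommGroup.torsion (Additive ℂˣ)
  have hdiv : ∀ {n : ℕ}, n ≠ 0 → Function.Surjective fun a : T => n • a := by
    rintro n hn ⟨a, ha⟩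
    obtain ⟨z, hz⟩ := IsAlgClosed.exists_pow_nat_eq (a.toMul : ℂ) (Nat.pos_of_ne_zero hn)
    have hz0 : z ≠ 0 := by
      rintro rfl
      rw [zero_pow hn] at hz
      exact (Units.ne_zero _ hz.symm)
    have hb : n • Additive.ofMul (Units.mk0 z hz0) = a := by
      apply Additive.toMul.injective
      ext
      simpa using hz
    refine ⟨⟨Additive.ofMul (Units.mk0 z hz0), ?_⟩, Subtype.ext hb⟩
    have ha' : IsOfFinAddOrder a := ha
    rw [← hb] at ha'
    exact ha'.of_nsmul hn
  let _ : DivisibleBy T ℕ := divisibleByOfSMulRightSurj T ℕ hdiv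
  let _ : DivisibleBy T ℤ := AddGroup.divisibleByIntOfDivisibleByNat T
  obtain ⟨f, hf⟩ := (Module.Baer.of_divisible T).extension_property_addMonoidHom
    T.subtype T.subtype_injective (AddMonoidHom.id T)
  refine ⟨MonoidHom.toAdditive.symm (T.subtype.comp f), fun u => ?_, fun u hu => ?_⟩
  · exact isOfFinAddOrder_ofMul_iff.1 (f (Additive.ofMul u)).2
  · have := DFunLike.congr_fun hf ⟨Additive.ofMul u, isOfFinAddOrder_ofMul_iff.2 hu⟩
    exact congrArg (fun z : T => (z : Additive ℂˣ).toMul) this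

/-! ### Algebraic integers -/

namespace MonicRatio

/-- The ring of algebraic integers in `ℂ`. -/
abbrev AlgInt : Type := integralClosure ℤ ℂ

/-- A rational algebraic integer lies in `ℤ`, and no integer lies strictly between `0` and `1`. -/
theorem nonneg_of_isIntegral_two_zpow {x : ℤ} (hx : IsIntegral ℤ ((2 : ℂ) ^ x)) : 0 ≤ x := by
  have h : IsIntegral ℤ ((2 : ℚ) ^ x) := by
    rw [← isIntegral_algebraMap_iff (algebraMap ℚ ℂ).injective]
    simpa using hx
  obtain ⟨y, hy⟩ := IsIntegrallyClosed.isIntegral_iff.1 h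
  by_contra! hneg
  have hy' : (y : ℚ) = 2 ^ x := hy
  have h0 : (0 : ℚ) < y := by rw [hy']; positivity
  have h1 : (y : ℚ) < 1 := by rw [hy']; exact zpow_lt_one_of_neg₀ (by norm_num) hneg
  have h0' : 0 < y := by exact_mod_cast h0
  have h1' : y < 1 := by exact_mod_cast h1
  omega

theorem AlgInt.coe_mul_coe_inv (s : AlgIntˣ) : ((s : AlgInt) : ℂ) * ((↑s⁻¹ : AlgInt) : ℂ) = 1 := by
  rw [← MulMemClass.coe_mul, s.mul_inv, OneMemClass.coe_one]

/-- Makes `AlgInt / p` a nonzero ring of characteristic `p`, where Frobenius is available. -/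
theorem natCast_prime_mem_nonunits {p : ℕ} (hp : p.Prime) : (p : AlgInt) ∈ nonunits AlgInt := by
  rintro ⟨u, hu⟩
  have h1 : (p : ℂ) * ((↑u⁻¹ : AlgInt) : ℂ) = 1 := by
    have := AlgInt.coe_mul_coe_inv u
    rwa [hu] at this
  have hp0 : (p : ℂ) ≠ 0 := by exact_mod_cast hp.ne_zero
  have h2 : ((↑u⁻¹ : AlgInt) : ℂ) = algebraMap ℚ ℂ (p : ℚ)⁻¹ := by
    rw [map_inv₀, map_natCast]
    exact (eq_inv_of_mul_eq_one_right h1)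
  have h3 : IsIntegral ℤ ((p : ℚ)⁻¹) := by
    rw [← isIntegral_algebraMap_iff (algebraMap ℚ ℂ).injective, ← h2]
    exact (↑u⁻¹ : AlgInt).2
  obtain ⟨y, hy⟩ := IsIntegrallyClosed.isIntegral_iff.1 h3
  have hy' : (y : ℚ) * p = 1 := by
    rw [show (y : ℚ) = (p : ℚ)⁻¹ from hy]
    exact inv_mul_cancel₀ (by exact_mod_cast hp.ne_zero)
  have hy2 : y * (p : ℤ) = 1 := by exact_mod_cast hy'
  have := Int.isUnit_iff.1 (IsUnit.of_mul_eq_one _ (mul_comm y p ▸ hy2))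
  have := hp.two_le
  omega

/-! ### Splitting off the roots of unity -/

section Twist

variable (τ : ℂˣ →* ℂˣ) (hτ : ∀ u, IsOfFinOrder (τ u)) (hτ' : ∀ u, IsOfFinOrder u → τ u = u)

theorem isMulTorsionFree_ker (hτ' : ∀ u, IsOfFinOrder u → τ u = u) :
    IsMulTorsionFree τ.ker := by
  rw [isMulTorsionFree_iff_not_isOfFinOrder]
  rintro ⟨v, hv⟩ hne hfin
  apply hne
  have := hτ' v (Submonoid.isOfFinOrder_coe.2 hfin)
  rw [MonoidHom.mem_ker] at hv
  exact Subtype.ext (this.symm.trans hv)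

/-- The component of `u` in the kernel of the retraction `τ`. -/
def kerPart (hτ : ∀ u, IsOfFinOrder (τ u)) (hτ' : ∀ u, IsOfFinOrder u → τ u = u) :
    ℂˣ →* τ.ker :=
  ((MonoidHom.id ℂˣ) / τ).codRestrict τ.ker fun u => by
    rw [MonoidHom.mem_ker, MonoidHom.div_apply, _root_.map_div, hτ' _ (hτ u), MonoidHom.id_apply, div_self']

/-- The retraction onto the roots of unity, with values in the algebraic integers. -/
def torsionPart (hτ : ∀ u, IsOfFinOrder (τ u)) : ℂˣ →* AlgInt :=
  ((Units.coeHom ℂ).comp τ).codRestrict (integralClosure ℤ ℂ) fun u => by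
    obtain ⟨n, hn, h⟩ := isOfFinOrder_iff_pow_eq_one.1 (hτ u)
    refine IsIntegral.of_pow hn ?_
    have : ((τ u : ℂˣ) : ℂ) ^ n = 1 := by rw [← Units.val_pow_eq_pow_val, h, Units.val_one]
    simpa [this] using isIntegral_one

/-- The multiplicative map `α ↦ ζⁿ [v]` for `α = ζ v` with `ζ` a root of unity and `v` in the
complement `ker τ`; it sends `0` to `0`. -/
def twistHom (n : ℕ) : ℂ →* MonoidAlgebra AlgInt τ.ker where
  toFun α := if h : α = 0 then 0 else
    MonoidAlgebra.single (kerPart τ hτ hτ' (Units.mk0 α h)) (torsionPart τ hτ (Units.mk0 α h) ^ n)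
  map_one' := by simp [MonoidAlgebra.one_def]
  map_mul' α β := by
    by_cases hα : α = 0
    · simp [hα]
    by_cases hβ : β = 0
    · simp [hβ]
    simp [hα, hβ, Units.mk0_mul, MonoidAlgebra.single_mul_single, mul_pow]

/-- The ring morphism `[α] ↦ ζⁿ [v]` extending `twistHom`. -/
def twist (n : ℕ) : MonoidAlgebra ℤ ℂ →+* MonoidAlgebra AlgInt τ.ker :=
  (MonoidAlgebra.lift ℤ _ ℂ (twistHom τ hτ hτ' n)).toRingHom

/-- Evaluation `∑ a_v [v] ↦ ∑ a_v vⁿ`. -/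
def evalPow (n : ℕ) : MonoidAlgebra AlgInt τ.ker →+* ℂ :=
  (MonoidAlgebra.lift AlgInt ℂ τ.ker
    ((powMonoidHom n).comp ((Units.coeHom ℂ).comp τ.ker.subtype))).toRingHom

theorem evalPow_single (n : ℕ) (v : τ.ker) (a : AlgInt) :
    evalPow τ n (MonoidAlgebra.single v a) = (a : ℂ) * ((v : ℂˣ) : ℂ) ^ n := by
  simp [evalPow, Algebra.smul_def]

/-- For `α = ζ v` both sides give `ζⁿ vⁿ = αⁿ`. The case `n = 0` fails at `[0]`, which the twist
kills while `0 ^ 0 = 1`. -/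
theorem evalPow_twist {n : ℕ} (hn : n ≠ 0) (x : MonoidAlgebra ℤ ℂ) :
    evalPow τ n (twist τ hτ hτ' n x) = tC n x := by
  have : (evalPow τ n).comp (twist τ hτ hτ' n) = tC n := by
    refine MonoidAlgebra.ringHom_ext (fun r => ?_) fun α => ?_
    · exact RingHom.congr_fun (RingHom.ext_int
        (((evalPow τ n).comp (twist τ hτ hτ' n)).comp MonoidAlgebra.singleOneRingHom)
        ((tC n).comp MonoidAlgebra.singleOneRingHom)) r
    · rw [tC_single, RingHom.comp_apply]
      by_cases hα : α = 0
      · simp [twist, twistHom, hα, hn]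
      · have : (kerPart τ hτ hτ' (Units.mk0 α hα) : ℂˣ) * τ (Units.mk0 α hα) = Units.mk0 α hα :=
          div_mul_cancel _ _
        have h2 : ((torsionPart τ hτ (Units.mk0 α hα) : AlgInt) : ℂ) = τ (Units.mk0 α hα) := rfl
        have h3 := congrArg Units.val this
        rw [Units.val_mul, Units.val_mk0] at h3
        have h4 : twist τ hτ hτ' n (MonoidAlgebra.single α 1) =
            MonoidAlgebra.single (kerPart τ hτ hτ' (Units.mk0 α hα))
              (torsionPart τ hτ (Units.mk0 α hα) ^ n) := by
          simp [twist, twistHom, hα]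
        rw [h4, evalPow_single, SubmonoidClass.coe_pow, h2, ← mul_pow, mul_comm, h3]
        simp
  exact DFunLike.congr_fun this x

theorem coeff_twist (n : ℕ) (x : MonoidAlgebra ℤ ℂ) (v : τ.ker) :
    (twist τ hτ hτ' n x).coeff v =
      ∑ α ∈ x.coeff.support, (x.coeff α : AlgInt) * (twistHom τ hτ hτ' n α).coeff v := by
  simp [twist, MonoidAlgebra.lift_apply, Finsupp.sum, MonoidAlgebra.coeff_sum,
    Finsupp.finsetSum_apply, ← zsmul_eq_mul]

theorem coeff_twistHom_mul (n : ℕ) {p : ℕ} (hp : p ≠ 0) (α : ℂ) (v : τ.ker) :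
    (twistHom τ hτ hτ' (n * p) α).coeff v = (twistHom τ hτ hτ' n α).coeff v ^ p := by
  classical
  by_cases hα : α = 0
  · simp [twistHom, hα, hp]
  · simp only [twistHom, MonoidHom.coe_mk, OneHom.coe_mk, hα, dite_false,
      MonoidAlgebra.coeff_single, Finsupp.single_apply]
    split_ifs
    · rw [pow_mul]
    · rw [zero_pow hp]

/-- Modulo `p`, the `p`-th power is additive and fixes the integer coefficients of `x`, while it
turns `ζⁿ` into `ζ^(np)`. -/
theorem mk_coeff_twist_mul (n : ℕ) {p : ℕ} (hp : p.Prime) (x : MonoidAlgebra ℤ ℂ) (v : τ.ker) :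
    Ideal.Quotient.mk (Ideal.span {(p : AlgInt)}) ((twist τ hτ hτ' (n * p) x).coeff v) =
      Ideal.Quotient.mk (Ideal.span {(p : AlgInt)}) ((twist τ hτ hτ' n x).coeff v) ^ p := by
  have : Fact p.Prime := ⟨hp⟩
  have := CharP.quotient AlgInt p (natCast_prime_mem_nonunits hp)
  rw [coeff_twist, coeff_twist, map_sum, map_sum, sum_pow_char]
  refine Finset.sum_congr rfl fun α _ => ?_
  rw [coeff_twistHom_mul _ _ _ _ hp.ne_zero, map_mul, map_mul, mul_pow, map_pow, map_intCast]
  congr 1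
  exact (map_intCast (frobenius (AlgInt ⧸ Ideal.span {(p : AlgInt)}) p) _).symm

end Twist

/-! ### Power sums of units -/

/-- The power sums of a unit of the ring of formal sums of complex numbers. -/
theorem exists_tC_eq_of_mul_eq_one {x y : MonoidAlgebra ℤ ℂ} (h : x * y = 1) :
    ∃ γ : ℂ, ∀ n : ℕ, n ≠ 0 → ∃ w : AlgIntˣ, tC n x = ((w : AlgInt) : ℂ) * γ ^ n := by
  obtain ⟨τ, hτ, hτ'⟩ := exists_torsion_retraction
  have := isMulTorsionFree_ker τ hτ'
  have := TwoUniqueProds.of_isMulTorsionFree τ.ker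
  have hn : ∀ n, ∃ (v : τ.ker) (w : AlgIntˣ), twist τ hτ hτ' n x =
      MonoidAlgebra.single v (w : AlgInt) := by
    intro n
    obtain ⟨v, a, ⟨w, rfl⟩, hva⟩ := MonoidAlgebra.eq_single_of_mul_eq_one
      (x := twist τ hτ hτ' n x) (y := twist τ hτ hτ' n y) (by rw [← map_mul, h, map_one])
    exact ⟨v, w, hva⟩
  choose v w hvw using hn
  have hstep : ∀ n p, p.Prime → v (n * p) = v n := by
    intro n p hp
    by_contra hne
    have : Nontrivial (AlgInt ⧸ Ideal.span {(p : AlgInt)}) :=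
      Ideal.Quotient.nontrivial_iff.2
        (Ideal.span_singleton_ne_top (natCast_prime_mem_nonunits hp))
    -- At `v n` the left side vanishes if `v (n * p) ≠ v n`, while the right side is a power of a
    -- unit in a nonzero ring.
    have h1 := mk_coeff_twist_mul τ hτ hτ' n hp x (v n)
    rw [hvw, hvw, MonoidAlgebra.coeff_single, MonoidAlgebra.coeff_single,
      Finsupp.single_eq_same, Finsupp.single_eq_of_ne (Ne.symm hne), map_zero] at h1
    exact (((w n).isUnit.map (Ideal.Quotient.mk (Ideal.span {(p : AlgInt)}))).pow p).ne_zero h1.symm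
  have hmul : ∀ n, n ≠ 0 → ∀ m, v (m * n) = v m := by
    intro n
    induction n using Nat.recOnMul with
    | zero => simp
    | one => simp
    | prime p hp => exact fun _ m => hstep m p hp
    | mul a b ha hb =>
      intro hab m
      rw [← mul_assoc, hb (right_ne_zero_of_mul hab), ha (left_ne_zero_of_mul hab)]
  refine ⟨((v 1 : ℂˣ) : ℂ), fun n hn => ⟨w n, ?_⟩⟩
  rw [← evalPow_twist τ hτ hτ' hn, hvw, evalPow_single, ← hmul n hn 1, one_mul]

/-! ### Power sums separate elements -/

theorem eq_of_forall_tC_eq {x y : MonoidAlgebra ℤ ℂ} (h : ∀ n, tC n x = tC n y) : x = y := by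
  classical
  have key : ∀ z : MonoidAlgebra ℤ ℂ, (∀ n, tC n z = 0) → z = 0 := by
    intro z hz
    have hsum : ∀ n, ∑ α ∈ z.coeff.support, (z.coeff α : ℂ) * α ^ n = 0 := by
      intro n
      rw [← hz n]
      simp [tC, MonoidAlgebra.lift_apply, Finsupp.sum, zsmul_eq_mul]
    have hpoly : ∀ P : ℂ[X], ∑ α ∈ z.coeff.support, (z.coeff α : ℂ) * P.eval α = 0 := by
      intro P
      simp only [eval_eq_sum_range, Finset.mul_sum]
      rw [Finset.sum_comm]
      refine Finset.sum_eq_zero fun n _ => ?_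
      have := congrArg (P.coeff n * ·) (hsum n)
      simp only [Finset.mul_sum, mul_zero] at this
      rw [← this]
      exact Finset.sum_congr rfl fun α _ => by ring
    ext α
    by_contra hα
    have hmem : α ∈ z.coeff.support := Finsupp.mem_support_iff.2 hα
    -- Lagrange interpolation: this polynomial vanishes on the support except at `α`, isolating the
    -- coefficient there.
    have := hpoly (∏ β ∈ z.coeff.support.erase α, (X - C β))
    rw [Finset.sum_eq_single α, eval_prod, mul_eq_zero, Finset.prod_eq_zero_iff] at this
    · rcases this with h0 | ⟨β, hβ, h0⟩
      · exact hα (by exact_mod_cast h0)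
      · rw [eval_sub, eval_X, eval_C, sub_eq_zero] at h0
        exact (Finset.mem_erase.1 hβ).1 h0.symm
    · intro β hβ hne
      rw [eval_prod, Finset.prod_eq_zero (Finset.mem_erase.2 ⟨hne, hβ⟩) (by simp), mul_zero]
    · exact fun hn => absurd hmem hn
  exact sub_eq_zero.1 (key _ fun n => by rw [map_sub, h n, sub_self])

theorem t_ext {r s : MQ} (h : ∀ n, t n r = t n s) : r = s :=
  Subtype.ext (eq_of_forall_tC_eq fun n => by rw [← t_spec, ← t_spec, h n])

theorem tC_lam (m n : ℕ) (r : MQ) : tC n (lam m r : MQ) = tC (m * n) (r : MonoidAlgebra ℤ ℂ) := by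
  have : (tC n).comp (MonoidAlgebra.mapDomainRingHom ℤ (powMonoidHom m : ℂ →* ℂ)) = tC (m * n) := by
    refine MonoidAlgebra.ringHom_ext (fun k => ?_) fun α => ?_
    · simp [tC_single]
    · simp [tC_single, pow_mul]
  exact DFunLike.congr_fun this (r : MonoidAlgebra ℤ ℂ)

theorem t_lam (m n : ℕ) (r : MQ) : t n (lam m r) = t (m * n) r := by
  apply Rat.cast_injective (α := ℂ)
  rw [t_spec, t_spec, tC_lam]

theorem exists_intCast_eq_t_zero (r : MQ) : ∃ d : ℤ, (d : ℚ) = t 0 r := by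
  refine ⟨∑ α ∈ (r : MonoidAlgebra ℤ ℂ).coeff.support, (r : MonoidAlgebra ℤ ℂ).coeff α, ?_⟩
  apply Rat.cast_injective (α := ℂ)
  rw [t_spec]
  simp [tC, MonoidAlgebra.lift_apply, Finsupp.sum, zsmul_eq_mul]

/-! ### Determination of `φ*` -/

variable (φ : MQ →+* MQ) (hφ : Continuous φ)

theorem phiStar_zero : phiStar φ hφ 0 = 0 := by
  obtain ⟨d, hd⟩ := exists_intCast_eq_t_zero (φ (lin (1 / 2)))
  rw [phiStar_spec φ hφ, t_lin] at hd
  by_contra hne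
  have h0 : (0 : ℚ) < d := by rw [hd]; positivity
  have h1 : (d : ℚ) < 1 := by rw [hd]; exact pow_lt_one₀ (by norm_num) (by norm_num) hne
  have h0' : 0 < d := by exact_mod_cast h0
  have h1' : d < 1 := by exact_mod_cast h1
  omega

theorem lin_two_mul_lin_half : lin 2 * lin (1 / 2) = 1 := by
  refine t_ext fun n => ?_
  rw [map_mul, t_lin, t_lin, map_one, ← mul_pow]
  norm_num

theorem phiStar_eq_mul (n : ℕ) : phiStar φ hφ n = phiStar φ hφ 1 * n := by
  rcases eq_or_ne n 0 with rfl | hn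
  · rw [phiStar_zero, mul_zero]
  obtain ⟨γ, hγ⟩ := exists_tC_eq_of_mul_eq_one
    (x := (φ (lin 2) : MonoidAlgebra ℤ ℂ)) (y := (φ (lin (1 / 2)) : MonoidAlgebra ℤ ℂ)) (by
      rw [← Subring.coe_mul, ← map_mul, lin_two_mul_lin_half, map_one, Subring.coe_one])
  have hpow : ∀ m, tC m (φ (lin 2) : MonoidAlgebra ℤ ℂ) = 2 ^ phiStar φ hφ m := by
    intro m
    rw [← t_spec, phiStar_spec φ hφ, t_lin]
    simp
  obtain ⟨w, hw⟩ := hγ 1 one_ne_zero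
  obtain ⟨u, hu⟩ := hγ n hn
  rw [hpow, pow_one] at hw
  rw [hpow] at hu
  have hγ0 : γ ≠ 0 := by
    rintro rfl
    rw [mul_zero] at hw
    exact pow_ne_zero _ two_ne_zero hw
  -- Dividing `2 ^ φ*(n) = u γⁿ` by the `n`-th power of `2 ^ φ*(1) = w γ` eliminates `γ`.
  have hrel : (((u * (w⁻¹) ^ n : AlgIntˣ) : AlgInt) : ℂ) =
      2 ^ ((phiStar φ hφ n : ℤ) - (phiStar φ hφ 1 * n : ℕ)) := by
    rw [zpow_sub₀ two_ne_zero, zpow_natCast, zpow_natCast, pow_mul, hu, hw, mul_pow,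
      eq_div_iff (mul_ne_zero (pow_ne_zero _ (left_ne_zero_of_mul_eq_one (AlgInt.coe_mul_coe_inv w)))
        (pow_ne_zero _ hγ0))]
    have : ((w : AlgInt) : ℂ) ^ n * ((↑w⁻¹ : AlgInt) : ℂ) ^ n = 1 := by
      rw [← mul_pow, AlgInt.coe_mul_coe_inv, one_pow]
    push_cast
    linear_combination ((u : AlgInt) : ℂ) * γ ^ n * this
  have h1 := nonneg_of_isIntegral_two_zpow (hrel ▸ (↑(u * (w⁻¹) ^ n) : AlgInt).2)
  -- The inverse is integral too, which bounds the exponent from the other side.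
  have hrel' : (((u * (w⁻¹) ^ n)⁻¹ : AlgIntˣ) : AlgInt) =
      (2 : ℂ) ^ (-((phiStar φ hφ n : ℤ) - (phiStar φ hφ 1 * n : ℕ))) := by
    rw [zpow_neg, ← hrel]
    exact eq_inv_of_mul_eq_one_right (AlgInt.coe_mul_coe_inv _)
  have h2 := nonneg_of_isIntegral_two_zpow (hrel' ▸ (↑(u * (w⁻¹) ^ n)⁻¹ : AlgInt).2)
  omega

end MonicRatio

end

theorem mainTheorem3 (φ : MonicRatio.MQ →+* MonicRatio.MQ) (hφ : Continuous φ)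
    (h1 : MonicRatio.phiStar φ hφ 1 ≠ 0)
    (hroot : ∃ k : ℕ, 2 ≤ k ∧
      ∃ α : ℂ, MonicRatio.IsRootOf (φ (MonicRatio.lin (k : ℚ))) α ∧ 1 < ‖α‖) :
    (∀ r : MonicRatio.MQ, ∃ d : ℤ,
      (d : ℚ) = MonicRatio.t (MonicRatio.phiStar φ hφ 0) r - MonicRatio.t 0 r ∧
      φ r = MonicRatio.lam (MonicRatio.phiStar φ hφ 1) r + d • MonicRatio.lin 0) ∧
    ∀ n : ℕ, MonicRatio.phiStar φ hφ n = MonicRatio.phiStar φ hφ 1 * n := by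
  -- The multiple of `[x]` is zero because `φ*(0) = 0`.
  refine ⟨fun r => ⟨0, ?_, ?_⟩, MonicRatio.phiStar_eq_mul φ hφ⟩
  · rw [MonicRatio.phiStar_zero, sub_self, Int.cast_zero]
  · rw [zero_smul, add_zero]
    refine MonicRatio.t_ext fun n => ?_
    rw [MonicRatio.phiStar_spec φ hφ, MonicRatio.t_lam, MonicRatio.phiStar_eq_mul]
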